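/- Let $G$ be an infinite group, $k$ a field, $n\ge 1$ an integer, and $V=k^n$. Configurations. For a set $A$, $G$ acts on $A^G$ by $(gx)(h)=x(g^{-1}h)$. For $M\subset G$, put $S=A^{A^M}$ and, for $s\in S^G$, let $\sigma_s\colon A^G\to A^G$ be the non-uniform cellular automaton (NUCA) with memory $M$ given by $\sigma_s(x)(g)=s(g)\big((g^{-1}x)|_M\big)$. Let $\Sigma(s)\subset S^G$ be the closure of the orbit $\{gs: g\in G\}$ in the prodiscrete topology. A map $\tau=\sigma_s$ with $M$ finite is called stably injective if $\sigma_p$ is injective for every $p\in\Sigma(s)$ (this depends only on $\tau$, not on $M$ and $s$). The ring $\mathrm{LNUCA}_c(G,V)$. It is the $k$-algebra of all linear maps $\tau\colon V^G\to V^G$ for which there are finite subsets $M,E\subset G$ and $s\in\mathcal L(V^M,V)^G$, where $\mathcal L(V^M,V)$ is the space of $k$-linear maps $V^M\to V$, such that $\tau=\sigma_s$ and $s(g)=s(h)$ for all $g,h\in G\setminus E$. Addition is component-wise and multiplication is composition. The ring $D^1(k[G])$. It is the additive group $k[G]\times (k[G])[G]$ with unit $(1_G,0)$ and multiplication $$(\alpha_1,\beta_1)*(\alpha_2,\beta_2)=(\alpha_1\alpha_2,\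 \alpha_1\beta_2+\beta_1\alpha_2+\beta_1\beta_2),$$ where $\alpha_1\alpha_2$ is the product in $k[G]$ and, for $\alpha\in k[G]$, $\beta,\gamma\in(k[G])[G]$ and $g,h\in G$, $$(\alpha\beta)(g)(h)=\sum_{t\in G}\alpha(t)\,\beta(gt)(t^{-1}h),\quad (\beta\alpha)(g)(h)=\sum_{t\in G}\beta(g)(t)\,\alpha(t^{-1}h),\quad (\beta\gamma)(g)(h)=\sum_{t\in G}\beta(g)(t)\,\gamma(gt)(t^{-1}h).$$ A ring $R$ is directly finite if $ab=1$ implies $ba=1$ for all $a,b\in R$; $M_n(R)$ is the ring of $n\times n$ matrices over $R$. Theorem. The following are equivalent: (i) every stably injective $\tau\in\mathrm{LNUCA}_c(G,k^n)$ is surjective; (ii) the ring $\mathrm{LNUCA}_c(G,k^n)$ is directly finite; (iii) the ring $M_n(D^1(k[G]))$ is directly finite. -/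

import Mathlib

/-! ### Non-uniform cellular automata -/

namespace NUCA

/-- The Bernoulli shift `(g x)(h) = x (g⁻¹ h)` on configurations. -/
def shift {G : Type*} [Group G] {A : Type*} (g : G) (x : G → A) : G → A :=
  fun h => x (g⁻¹ * h)

/-- The non-uniform cellular automaton with memory `M` and configuration of local defining
maps `s`: `σ_s(x)(g) = s(g)((g⁻¹ x)|_M)`. -/
def nuca {G : Type*} [Group G] {A : Type*} (M : Set G) (s : G → ((M → A) → A))
    (x : G → A) : G → A :=
  fun g => s g (fun m : M => shift g⁻¹ x m)

/-- `Σ(s)`: the closure of the orbit of `s` under the shift, for the prodiscrete topology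
(the product over `G` of the discrete topology on `S`). -/
def orbitClosure {G : Type*} [Group G] {S : Type*} (s : G → S) : Set (G → S) :=
  @closure (G → S) (@Pi.topologicalSpace G (fun _ => S) (fun _ => ⊥))
    (Set.range fun g : G => shift g s)

/-- `σ_p` is injective for every `p ∈ Σ(s)`. -/
def ConfigStablyInjective {G : Type*} [Group G] {A : Type*} (M : Set G)
    (s : G → ((M → A) → A)) : Prop :=
  ∀ p ∈ orbitClosure s, Function.Injective (nuca M p)

/-- A map `τ : A^G → A^G` is a stably injective NUCA with finite memory: it is `σ_s` for some
`s` with finite memory such that `σ_p` is injective for every `p ∈ Σ(s)`. The choice of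
`M` and `s` does not matter, see `configStablyInjective_iff`. -/
def StablyInjective {G : Type*} [Group G] {A : Type*} (τ : (G → A) → (G → A)) : Prop :=
  ∃ (M : Set G) (s : G → ((M → A) → A)),
    M.Finite ∧ τ = nuca M s ∧ ConfigStablyInjective M s

theorem nuca_apply {G : Type*} [Group G] {A : Type*} (M : Set G) (s : G → ((M → A) → A))
    (x : G → A) (g : G) : nuca M s x g = s g (fun m => x (g * m)) := by
  simp only [nuca, shift, inv_inv]

theorem mem_orbitClosure_iff {G : Type*} [Group G] {S : Type*} (s p : G → S) :
    p ∈ orbitClosure s ↔ ∀ F : Finset G, ∃ g : G, ∀ h ∈ F, p h = s (g⁻¹ * h) := by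
  let _ : TopologicalSpace S := ⊥
  have : DiscreteTopology S := ⟨rfl⟩
  change p ∈ closure (Set.range fun g : G => shift g s) ↔ _
  rw [mem_closure_iff]
  constructor
  · intro H F
    obtain ⟨y, hy, g, rfl⟩ := H ((F : Set G).pi fun h => {p h})
      (isOpen_set_pi F.finite_toSet fun _ _ => isOpen_discrete _) (by simp [Set.mem_pi])
    exact ⟨g, fun h hh => (hy h hh).symm⟩
  · intro H U hU hp
    obtain ⟨F, u, hu, hFU⟩ := isOpen_pi_iff.1 hU p hp
    obtain ⟨g, hg⟩ := H F
    refine ⟨shift g s, hFU fun h hh => ?_, g, rfl⟩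
    change s (g⁻¹ * h) ∈ u h
    rw [← hg h hh]
    exact (hu h hh).2

theorem ConfigStablyInjective.of_nuca_eq {G : Type*} [Group G] {A : Type*} [Nonempty A]
    {M M' : Set G} {s : G → ((M → A) → A)} {s' : G → ((M' → A) → A)}
    (e : nuca M s = nuca M' s') (H : ConfigStablyInjective M' s') :
    ConfigStablyInjective M s := by
  classical
  intro p hp
  rw [mem_orbitClosure_iff] at hp
  -- the local maps of the two configurations agree after restriction
  have key : ∀ (g : G) (w : G → A), s g (fun m => w m) = s' g (fun m => w m) := by
    intro g w
    have := congrFun (congrFun e (fun h => w (g⁻¹ * h))) g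
    simpa [nuca_apply] using this
  let a : A := Classical.arbitrary A
  let p' : G → ((M' → A) → A) := fun h w =>
    p h (fun m => if hm : (m : G) ∈ M' then w ⟨m, hm⟩ else a)
  have hloc : ∀ h g : G, p h = s g → p' h = s' g := by
    intro h g hg
    funext w
    have h1 := key g (fun m => if hm : m ∈ M' then w ⟨m, hm⟩ else a)
    simp only [p', hg]
    rw [h1]
    congr 1
    funext m
    simp
  have hp' : p' ∈ orbitClosure s' := by
    rw [mem_orbitClosure_iff]
    intro F
    obtain ⟨g, hg⟩ := hp F
    exact ⟨g, fun h hh => hloc _ _ (hg h hh)⟩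
  have : nuca M p = nuca M' p' := by
    funext x h
    obtain ⟨g, hg⟩ := hp {h}
    have hg := hg h (by simp)
    rw [nuca_apply, nuca_apply, hloc _ _ hg, hg, key _ fun m => x (h * m)]
  rw [this]
  exact H p' hp'

/-- Stable injectivity depends only on the map `σ_s`, not on `M` and `s`. -/
theorem configStablyInjective_iff {G : Type*} [Group G] {A : Type*} [Nonempty A]
    {M M' : Set G} {s : G → ((M → A) → A)} {s' : G → ((M' → A) → A)}
    (e : nuca M s = nuca M' s') :
    ConfigStablyInjective M s ↔ ConfigStablyInjective M' s' :=
  ⟨.of_nuca_eq e.symm, .of_nuca_eq e⟩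

/-- `τ` is a linear NUCA with finite memory which admits an asymptotically constant
configuration of (linear) local defining maps. -/
def IsLNUCAc (k : Type*) {G V : Type*} [Group G] [Field k] [AddCommGroup V] [Module k V]
    (τ : (G → V) → (G → V)) : Prop :=
  ∃ (M E : Set G) (s : G → ((M → V) →ₗ[k] V)), M.Finite ∧ E.Finite ∧
    τ = nuca M (fun g => ⇑(s g)) ∧ ∀ g h : G, g ∉ E → h ∉ E → s g = s h

section Closure

variable {k G V : Type*} [Group G] [Field k] [AddCommGroup V] [Module k V]

/-- Restriction of a finite pattern. -/
def resₗ (k V : Type*) {G : Type*} [Field k] [AddCommGroup V] [Module k V] {M N : Set G}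
    (h : M ⊆ N) : (N → V) →ₗ[k] (M → V) :=
  LinearMap.funLeft k V (Set.inclusion h)

theorem IsLNUCAc.add {τ τ' : (G → V) → (G → V)} (hτ : IsLNUCAc k τ) (hτ' : IsLNUCAc k τ') :
    IsLNUCAc k (τ + τ') := by
  obtain ⟨M, E, s, hM, hE, rfl, hs⟩ := hτ
  obtain ⟨M', E', s', hM', hE', rfl, hs'⟩ := hτ'
  refine ⟨M ∪ M', E ∪ E', fun g => s g ∘ₗ resₗ k V Set.subset_union_left +
    s' g ∘ₗ resₗ k V Set.subset_union_right, hM.union hM', hE.union hE', ?_, ?_⟩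
  · funext x g
    simp only [Pi.add_apply, nuca_apply]
    rfl
  · intro g h hg hh
    simp only [Set.mem_union, not_or] at hg hh
    simp only [hs g h hg.1 hh.1, hs' g h hg.2 hh.2]

theorem IsLNUCAc.comp {τ τ' : (G → V) → (G → V)} (hτ : IsLNUCAc k τ)
    (hτ' : IsLNUCAc k τ') : IsLNUCAc k (τ ∘ τ') := by
  obtain ⟨M, E, s, hM, hE, rfl, hs⟩ := hτ
  obtain ⟨M', E', s', hM', hE', rfl, hs'⟩ := hτ'
  refine ⟨Set.image2 (· * ·) M M', E ∪ Set.image2 (fun e m => e * m⁻¹) E' M,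
    fun g => s g ∘ₗ LinearMap.pi fun m => s' (g * m) ∘ₗ
      LinearMap.funLeft k V (fun m' : M' => ⟨m * m', Set.mem_image2_of_mem m.2 m'.2⟩),
    hM.image2 _ hM', hE.union (hE'.image2 _ hM), ?_, ?_⟩
  · funext x g
    simp only [Function.comp_apply, nuca_apply, LinearMap.comp_apply]
    congr 1
    funext m
    simp only [LinearMap.pi_apply, LinearMap.comp_apply, mul_assoc]
    rfl
  · intro g h hg hh
    simp only [Set.mem_union, not_or] at hg hh
    have aux : ∀ (u : G) (m : M), u ∉ Set.image2 (fun e m => e * m⁻¹) E' M → u * m ∉ E' :=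
      fun u m hu hum => hu ⟨u * m, hum, m, m.2, by simp⟩
    have h2 : ∀ m : M, s' (g * m) = s' (h * m) :=
      fun m => hs' _ _ (aux g m hg.2) (aux h m hh.2)
    simp only [hs g h hg.1 hh.1, h2]

theorem IsLNUCAc.smul_id (c : k) : IsLNUCAc k (fun x : G → V => c • x) := by
  refine ⟨{1}, ∅, fun _ => c • LinearMap.proj ⟨1, rfl⟩, Set.finite_singleton _,
    Set.finite_empty, ?_, fun _ _ _ _ => rfl⟩
  funext x g
  simp [nuca_apply]

end Closure

/-- `LNUCA_c(G, V)`: the `k`-algebra of all linear NUCA `V^G → V^G` with finite memory which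
admit asymptotically constant configurations of local defining maps, with component-wise
addition and composition as multiplication. -/
def LNUCAc (k G V : Type*) [Group G] [Field k] [AddCommGroup V] [Module k V] :
    Subalgebra k (Module.End k (G → V)) where
  carrier := {τ | IsLNUCAc k (⇑τ : (G → V) → (G → V))}
  mul_mem' hτ hτ' := hτ.comp hτ'
  add_mem' hτ hτ' := hτ.add hτ'
  algebraMap_mem' c := IsLNUCAc.smul_id c

end NUCA

/-! ### The twisted group ring `D¹(k[G])` -/

/-- The underlying set `k[G] × (k[G])[G]` of `D¹(k[G])`: pairs of a regular part and a
singular part. -/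
@[ext]
structure DOne (k G : Type*) [Ring k] [Group G] where
  /-- The regular part. -/
  reg : MonoidAlgebra k G
  /-- The singular part. -/
  sing : MonoidAlgebra (MonoidAlgebra k G) G

namespace DOne

noncomputable section

variable {k G : Type*} [Ring k] [Group G]

/-- `∑ t, (α(t) t) · f(t)` in `k[G]`, so its coefficient at `h` is `∑ t, α(t) f(t)(t⁻¹ h)`. -/
def twist (α : MonoidAlgebra k G) (f : G → MonoidAlgebra k G) : MonoidAlgebra k G :=
  α.coeff.sum fun t r => MonoidAlgebra.single t r * f t

theorem twist_coeff (α : MonoidAlgebra k G) (f : G → MonoidAlgebra k G) (h : G) :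
    (twist α f).coeff h = ∑ t ∈ α.coeff.support, α.coeff t * (f t).coeff (t⁻¹ * h) := by
  simp only [twist, Finsupp.sum, MonoidAlgebra.coeff_sum, Finsupp.finsetSum_apply]
  refine Finset.sum_congr rfl fun t _ => ?_
  exact MonoidAlgebra.coeff_single_mul_eq_mul_coeff (t⁻¹ * h)
    (fun m _ => by rw [eq_inv_mul_iff_mul_eq])

@[simp] theorem twist_zero_left (f : G → MonoidAlgebra k G) : twist 0 f = 0 := by
  simp [twist]

@[simp] theorem twist_zero_right (α : MonoidAlgebra k G) : twist α (fun _ => 0) = 0 := by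
  simp [twist]

theorem twist_add_left (α α' : MonoidAlgebra k G) (f : G → MonoidAlgebra k G) :
    twist (α + α') f = twist α f + twist α' f := by
  classical
  simp only [twist, MonoidAlgebra.coeff_add]
  exact Finsupp.sum_add_index (by simp) (by intros; simp [add_mul])

theorem twist_add_right (α : MonoidAlgebra k G) (f f' : G → MonoidAlgebra k G) :
    twist α (fun t => f t + f' t) = twist α f + twist α f' := by
  simp only [twist, mul_add, Finsupp.sum_add]

theorem twist_single (t : G) (r : k) (f : G → MonoidAlgebra k G) :
    twist (MonoidAlgebra.single t r) f = MonoidAlgebra.single t r * f t := by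
  simp [twist]

theorem twist_const (α β : MonoidAlgebra k G) : twist α (fun _ => β) = α * β := by
  induction α using MonoidAlgebra.induction_linear with
  | zero => simp
  | add x y hx hy => rw [twist_add_left, hx, hy, add_mul]
  | single t r => rw [twist_single]

theorem twist_mul_single (t : G) (r : k) (β : MonoidAlgebra k G) (c : G → MonoidAlgebra k G) :
    twist (MonoidAlgebra.single t r * β) c
      = MonoidAlgebra.single t r * twist β (fun u => c (t * u)) := by
  induction β using MonoidAlgebra.induction_linear with
  | zero => simp
  | add x y hx hy => rw [mul_add, twist_add_left, hx, hy, twist_add_left, mul_add]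
  | single u q =>
    rw [MonoidAlgebra.single_mul_single, twist_single, twist_single, ← mul_assoc,
      MonoidAlgebra.single_mul_single]

theorem twist_twist (α : MonoidAlgebra k G) (b c : G → MonoidAlgebra k G) :
    twist (twist α b) c = twist α (fun t => twist (b t) (fun u => c (t * u))) := by
  induction α using MonoidAlgebra.induction_linear with
  | zero => simp
  | add x y hx hy => rw [twist_add_left, twist_add_left, hx, hy, twist_add_left]
  | single t r => rw [twist_single, twist_single, twist_mul_single]

/-- The twisted product `αβ`, with `(αβ)(g)(h) = ∑ t, α(t) β(gt)(t⁻¹h)`. -/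
def regMulSing (α : MonoidAlgebra k G) (β : MonoidAlgebra (MonoidAlgebra k G) G) :
    MonoidAlgebra (MonoidAlgebra k G) G :=
  .ofCoeff <| Finsupp.ofSupportFinite (fun g => twist α (fun t => β.coeff (g * t))) <| by
    refine (Set.Finite.image2 (fun u t => u * t⁻¹) β.coeff.hasFiniteSupport
      α.coeff.hasFiniteSupport).subset fun g hg => ?_
    obtain ⟨t, ht, h⟩ := Finset.exists_ne_zero_of_sum_ne_zero hg
    refine ⟨g * t, ?_, t, Finsupp.mem_support_iff.1 ht, by simp⟩
    intro h0
    apply h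
    simp only [h0, mul_zero]

/-- The twisted product `βα`, with `(βα)(g)(h) = ∑ t, β(g)(t) α(t⁻¹h)`. -/
def singMulReg (β : MonoidAlgebra (MonoidAlgebra k G) G) (α : MonoidAlgebra k G) :
    MonoidAlgebra (MonoidAlgebra k G) G :=
  .ofCoeff <| Finsupp.ofSupportFinite (fun g => twist (β.coeff g) (fun _ => α)) <|
    β.coeff.hasFiniteSupport.subset fun g hg h0 => hg (by simp only [h0, twist_zero_left])

/-- The twisted product `βγ`, with `(βγ)(g)(h) = ∑ t, β(g)(t) γ(gt)(t⁻¹h)`. -/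
def singMulSing (β γ : MonoidAlgebra (MonoidAlgebra k G) G) :
    MonoidAlgebra (MonoidAlgebra k G) G :=
  .ofCoeff <| Finsupp.ofSupportFinite
    (fun g => twist (β.coeff g) (fun t => γ.coeff (g * t))) <|
    β.coeff.hasFiniteSupport.subset fun g hg h0 => hg (by simp only [h0, twist_zero_left])

theorem regMulSing_coeff (α : MonoidAlgebra k G) (β : MonoidAlgebra (MonoidAlgebra k G) G)
    (g : G) : (regMulSing α β).coeff g = twist α (fun t => β.coeff (g * t)) := rfl

theorem singMulReg_coeff (β : MonoidAlgebra (MonoidAlgebra k G) G) (α : MonoidAlgebra k G)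
    (g : G) : (singMulReg β α).coeff g = twist (β.coeff g) (fun _ => α) := rfl

theorem singMulSing_coeff (β γ : MonoidAlgebra (MonoidAlgebra k G) G) (g : G) :
    (singMulSing β γ).coeff g = twist (β.coeff g) (fun t => γ.coeff (g * t)) := rfl

theorem regMulSing_coeff_coeff (α : MonoidAlgebra k G)
    (β : MonoidAlgebra (MonoidAlgebra k G) G) (g h : G) :
    ((regMulSing α β).coeff g).coeff h
      = ∑ t ∈ α.coeff.support, α.coeff t * (β.coeff (g * t)).coeff (t⁻¹ * h) := by
  rw [regMulSing_coeff, twist_coeff]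

theorem singMulReg_coeff_coeff (β : MonoidAlgebra (MonoidAlgebra k G) G)
    (α : MonoidAlgebra k G) (g h : G) :
    ((singMulReg β α).coeff g).coeff h
      = ∑ t ∈ (β.coeff g).coeff.support, (β.coeff g).coeff t * α.coeff (t⁻¹ * h) := by
  rw [singMulReg_coeff, twist_coeff]

theorem singMulSing_coeff_coeff (β γ : MonoidAlgebra (MonoidAlgebra k G) G) (g h : G) :
    ((singMulSing β γ).coeff g).coeff h = ∑ t ∈ (β.coeff g).coeff.support,
      (β.coeff g).coeff t * (γ.coeff (g * t)).coeff (t⁻¹ * h) := by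
  rw [singMulSing_coeff, twist_coeff]

instance : Zero (DOne k G) := ⟨⟨0, 0⟩⟩
instance : Add (DOne k G) := ⟨fun x y => ⟨x.reg + y.reg, x.sing + y.sing⟩⟩
instance : Neg (DOne k G) := ⟨fun x => ⟨-x.reg, -x.sing⟩⟩
instance : One (DOne k G) := ⟨⟨1, 0⟩⟩

/-- `(α₁, β₁) * (α₂, β₂) = (α₁ α₂, α₁ β₂ + β₁ α₂ + β₁ β₂)`, with the twisted products in the
second component. -/
instance : Mul (DOne k G) :=
  ⟨fun x y => ⟨x.reg * y.reg,
    regMulSing x.reg y.sing + singMulReg x.sing y.reg + singMulSing x.sing y.sing⟩⟩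

@[simp] theorem zero_reg : (0 : DOne k G).reg = 0 := rfl
@[simp] theorem zero_sing : (0 : DOne k G).sing = 0 := rfl
@[simp] theorem add_reg (x y : DOne k G) : (x + y).reg = x.reg + y.reg := rfl
@[simp] theorem add_sing (x y : DOne k G) : (x + y).sing = x.sing + y.sing := rfl
@[simp] theorem neg_reg (x : DOne k G) : (-x).reg = -x.reg := rfl
@[simp] theorem neg_sing (x : DOne k G) : (-x).sing = -x.sing := rfl
@[simp] theorem one_reg : (1 : DOne k G).reg = 1 := rfl
@[simp] theorem one_sing : (1 : DOne k G).sing = 0 := rfl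
@[simp] theorem mul_reg (x y : DOne k G) : (x * y).reg = x.reg * y.reg := rfl
theorem mul_sing (x y : DOne k G) : (x * y).sing =
    regMulSing x.reg y.sing + singMulReg x.sing y.reg + singMulSing x.sing y.sing := rfl

/-- The sum of the regular part and the value of the singular part at `g`. -/
def tot (x : DOne k G) (g : G) : MonoidAlgebra k G := x.reg + x.sing.coeff g

theorem ext_tot {x y : DOne k G} (h : x.reg = y.reg) (h' : ∀ g, x.tot g = y.tot g) :
    x = y := by
  refine DOne.ext h (MonoidAlgebra.coeff_injective (Finsupp.ext fun g => ?_))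
  have := h' g
  rw [tot, tot, h] at this
  exact add_left_cancel this

theorem tot_zero (g : G) : (0 : DOne k G).tot g = 0 := by simp [tot]

theorem tot_one (g : G) : (1 : DOne k G).tot g = 1 := by simp [tot]

theorem tot_add (x y : DOne k G) (g : G) : (x + y).tot g = x.tot g + y.tot g := by
  simp only [tot, add_reg, add_sing, MonoidAlgebra.coeff_add, Finsupp.add_apply]
  abel

theorem tot_mul (x y : DOne k G) (g : G) :
    (x * y).tot g = twist (x.tot g) (fun t => y.tot (g * t)) := by
  simp only [tot, mul_reg, mul_sing, MonoidAlgebra.coeff_add, Finsupp.add_apply,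
    regMulSing_coeff, singMulReg_coeff, singMulSing_coeff, twist_add_left, twist_add_right,
    twist_const, add_mul]
  abel

/-- `D¹(k[G])` is a ring with unit `(1, 0)`. -/
instance : Ring (DOne k G) where
  add_assoc x y z := by ext1 <;> simp [add_assoc]
  zero_add x := by ext1 <;> simp
  add_zero x := by ext1 <;> simp
  add_comm x y := by ext1 <;> simp [add_comm]
  neg_add_cancel x := by ext1 <;> simp
  nsmul := nsmulRec
  zsmul := zsmulRec
  mul_assoc x y z := by
    refine ext_tot (by simp [mul_assoc]) fun g => ?_
    simp only [tot_mul, twist_twist, mul_assoc]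
  one_mul x := by
    refine ext_tot (by simp) fun g => ?_
    rw [tot_mul, tot_one, MonoidAlgebra.one_def, twist_single, ← MonoidAlgebra.one_def,
      one_mul, mul_one]
  mul_one x := by
    refine ext_tot (by simp) fun g => ?_
    simp only [tot_mul, tot_one, twist_const, mul_one]
  zero_mul x := by
    refine ext_tot (by simp) fun g => ?_
    simp only [tot_mul, tot_zero, twist_zero_left]
  mul_zero x := by
    refine ext_tot (by simp) fun g => ?_
    simp only [tot_mul, tot_zero, twist_zero_right]
  left_distrib x y z := by
    refine ext_tot (by simp [mul_add]) fun g => ?_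
    simp only [tot_mul, tot_add, twist_add_right]
  right_distrib x y z := by
    refine ext_tot (by simp [add_mul]) fun g => ?_
    simp only [tot_mul, tot_add, twist_add_left]

end

end DOne

/-! ### Convolution operators on `k`-valued configurations -/

namespace DOne

noncomputable section

section Pair

variable {k G : Type*} [Ring k] [Group G]

/-! Two facts carry the proof. An element of `DOne k G` amounts to its total configuration `tot`, a
map from `G` to `k[G]` that is constant off a finite set. In these terms the four-term product
becomes the single twisted product `twist` (`tot_mul`), which is composition of the operators `pair`
(`pair_twist`). Passing to matrices gives `matrixEquivLNUCAc`. Infiniteness of `G` makes the regular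
part recoverable as the value off a finite set. So (ii) and (iii) concern isomorphic rings. Next,
stable injectivity in `LNUCAc` is the same as having a left inverse there. A left inverse of finite
memory recovers a coordinate from a finite window, and a limit of translates looks like one
translate on that window (`of_leftInverse`). Conversely, linear duality gives an injective linear
automaton a left inverse at each point (`exists_local_leftInverse`). Applying this to the constant
limit of the configuration and to finitely many exceptional points yields an asymptotically constant
left inverse (`exists_leftInverse`). Hence (i) says that left invertible elements are surjective,
which is direct finiteness. -/

/-- `∑ t, α(t) y(gt)`. -/
def pair (α : MonoidAlgebra k G) (y : G → k) (g : G) : k :=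
  α.coeff.sum fun t r => r * y (g * t)

@[simp] theorem pair_zero_left (y : G → k) (g : G) : pair 0 y g = 0 := by
  simp [pair]

theorem pair_add_left (α β : MonoidAlgebra k G) (y : G → k) (g : G) :
    pair (α + β) y g = pair α y g + pair β y g := by
  classical
  simp only [pair, MonoidAlgebra.coeff_add]
  exact Finsupp.sum_add_index (by simp) (by intros; simp [add_mul])

theorem pair_single (t : G) (r : k) (y : G → k) (g : G) :
    pair (MonoidAlgebra.single t r) y g = r * y (g * t) := by
  simp [pair]

theorem pair_add_right (α : MonoidAlgebra k G) (y z : G → k) (g : G) :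
    pair α (fun u => y u + z u) g = pair α y g + pair α z g := by
  simp only [pair, mul_add, Finsupp.sum_add]

theorem pair_sum_left {ι : Type*} (s : Finset ι) (α : ι → MonoidAlgebra k G) (y : G → k)
    (g : G) : pair (∑ l ∈ s, α l) y g = ∑ l ∈ s, pair (α l) y g := by
  classical
  induction s using Finset.induction_on with
  | empty => simp
  | insert a s ha ih => rw [Finset.sum_insert ha, Finset.sum_insert ha, pair_add_left, ih]

theorem pair_sum_right {ι : Type*} (s : Finset ι) (α : MonoidAlgebra k G) (y : ι → G → k)
    (g : G) : pair α (fun u => ∑ l ∈ s, y l u) g = ∑ l ∈ s, pair α (y l) g := by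
  simp only [pair, Finset.mul_sum, Finsupp.sum]
  exact Finset.sum_comm

theorem pair_eq_sum_of_subset (α : MonoidAlgebra k G) (y : G → k) (g : G) {M : Finset G}
    (h : α.coeff.support ⊆ M) : pair α y g = ∑ t ∈ M, α.coeff t * y (g * t) :=
  Finsupp.sum_of_support_subset _ h _ (by simp)

theorem pair_congr (α : MonoidAlgebra k G) {y z : G → k} {g : G}
    (h : ∀ t ∈ α.coeff.support, y (g * t) = z (g * t)) : pair α y g = pair α z g :=
  Finset.sum_congr rfl fun t ht => by simp only [h t ht]

theorem pair_translate (α : MonoidAlgebra k G) (y : G → k) (g : G) :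
    pair α (fun u => y (g * u)) 1 = pair α y g := by
  simp [pair]

theorem pair_delta [DecidableEq G] (α : MonoidAlgebra k G) (g t : G) :
    pair α (Pi.single (g * t) 1) g = α.coeff t := by
  rw [pair, Finsupp.sum, Finset.sum_eq_single t]
  · simp
  · intro u _ hu
    simp [hu]
  · intro ht
    simp [Finsupp.notMem_support_iff.1 ht]

theorem pair_single_mul (t : G) (r : k) (β : MonoidAlgebra k G) (y : G → k) (g : G) :
    pair (MonoidAlgebra.single t r * β) y g = r * pair β y (g * t) := by
  induction β using MonoidAlgebra.induction_linear with
  | zero => simp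
  | add a b ha hb => rw [mul_add, pair_add_left, ha, hb, pair_add_left, mul_add]
  | single u q => rw [MonoidAlgebra.single_mul_single, pair_single, pair_single, mul_assoc, mul_assoc]

/-- The reason the shift `g * t` occurs in the product of `D¹(k[G])`: with it, twisting corresponds
to applying one operator after another. -/
theorem pair_twist (α : MonoidAlgebra k G) (f : G → MonoidAlgebra k G) (y : G → k) (g : G) :
    pair (twist α (fun t => f (g * t))) y g = pair α (fun u => pair (f u) y u) g := by
  induction α using MonoidAlgebra.induction_linear with
  | zero => simp
  | add a b ha hb => rw [twist_add_left, pair_add_left, ha, hb, pair_add_left]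
  | single t r => rw [twist_single, pair_single_mul, pair_single]

/-- The element of `D¹(k[G])` with regular part `c₀` and total configuration `c`. -/
def ofTot (c : G → MonoidAlgebra k G) (c₀ : MonoidAlgebra k G)
    (h : {g | c g ≠ c₀}.Finite) : DOne k G :=
  ⟨c₀, .ofCoeff <| Finsupp.ofSupportFinite (fun g => c g - c₀) <|
    h.subset fun _ hg => sub_ne_zero.1 hg⟩

theorem tot_ofTot (c : G → MonoidAlgebra k G) (c₀ : MonoidAlgebra k G)
    (h : {g | c g ≠ c₀}.Finite) (g : G) : (ofTot c c₀ h).tot g = c g :=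
  add_sub_cancel c₀ (c g)

theorem tot_of_notMem (x : DOne k G) {g : G} (hg : g ∉ x.sing.coeff.support) :
    x.tot g = x.reg := by
  rw [tot, Finsupp.notMem_support_iff.1 hg, add_zero]

/-- At a point outside both singular supports the total configurations equal the regular parts; such
a point exists because `G` is infinite. -/
theorem ext_tot_of_infinite [Infinite G] {x y : DOne k G} (h : ∀ g, x.tot g = y.tot g) :
    x = y := by
  classical
  refine ext_tot ?_ h
  obtain ⟨g, hg⟩ := Infinite.exists_notMem_finset (x.sing.coeff.support ∪ y.sing.coeff.support)
  rw [Finset.mem_union, not_or] at hg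
  rw [← x.tot_of_notMem hg.1, ← y.tot_of_notMem hg.2, h]

theorem tot_sum {ι : Type*} (s : Finset ι) (x : ι → DOne k G) (g : G) :
    (∑ l ∈ s, x l).tot g = ∑ l ∈ s, (x l).tot g := by
  classical
  induction s using Finset.induction_on with
  | empty => simp [tot_zero]
  | insert a s ha ih => rw [Finset.sum_insert ha, Finset.sum_insert ha, tot_add, ih]

/-- Supplies a memory set valid at all points at once: `tot` takes only finitely many values. -/
theorem exists_finset_support_tot (x : DOne k G) :
    ∃ M : Finset G, ∀ g, (x.tot g).coeff.support ⊆ M := by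
  classical
  refine ⟨x.reg.coeff.support ∪
    x.sing.coeff.support.biUnion fun g => (x.sing.coeff g).coeff.support, fun g => ?_⟩
  by_cases hg : g ∈ x.sing.coeff.support
  · rw [tot, MonoidAlgebra.coeff_add]
    exact Finsupp.support_add.trans (Finset.union_subset_union_right
      (Finset.subset_biUnion_of_mem (fun g => (x.sing.coeff g).coeff.support) hg))
  · rw [tot_of_notMem x hg]
    exact Finset.subset_union_left

end Pair

/-! ### Matrices over `D¹(k[G])` as linear cellular automata -/

section Operator

variable {k G : Type*} [Field k] [Group G] {n : ℕ}

/-- The linear map of configurations given by a matrix over `D¹(k[G])`. -/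
def operator (A : Matrix (Fin n) (Fin n) (DOne k G)) : Module.End k (G → Fin n → k) where
  toFun x g i := ∑ j, pair ((A i j).tot g) (fun u => x u j) g
  map_add' x y := by
    funext g i
    simp only [Pi.add_apply, pair_add_right, Finset.sum_add_distrib]
  map_smul' c x := by
    funext g i
    simp only [Pi.smul_apply, smul_eq_mul, RingHom.id_apply, pair, Finsupp.sum,
      Finset.mul_sum, mul_left_comm c]

theorem operator_apply (A : Matrix (Fin n) (Fin n) (DOne k G)) (x : G → Fin n → k) (g : G)
    (i : Fin n) : operator A x g i = ∑ j, pair ((A i j).tot g) (fun u => x u j) g := rfl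

theorem operator_mem (A : Matrix (Fin n) (Fin n) (DOne k G)) :
    operator A ∈ NUCA.LNUCAc k G (Fin n → k) := by
  classical
  choose S hS using fun i j => (A i j).exists_finset_support_tot
  let M : Finset G := Finset.univ.biUnion fun i => Finset.univ.biUnion fun j => S i j
  let E : Finset G :=
    Finset.univ.biUnion fun i => Finset.univ.biUnion fun j => (A i j).sing.coeff.support
  have hM : ∀ i j g, ((A i j).tot g).coeff.support ⊆ M := fun i j g =>
    (hS i j g).trans fun t ht => by
      simp only [M, Finset.mem_biUnion, Finset.mem_univ, true_and]
      exact ⟨i, j, ht⟩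
  have hE : ∀ i j g, g ∉ (E : Set G) → (A i j).tot g = (A i j).reg := fun i j g hg =>
    tot_of_notMem _ fun h => hg <| by
      simp only [E, Finset.mem_coe, Finset.mem_biUnion, Finset.mem_univ, true_and]
      exact ⟨i, j, h⟩
  refine ⟨M, E, fun g => LinearMap.pi fun i => ∑ j, ∑ m : (M : Set G),
    ((A i j).tot g).coeff m • ((LinearMap.proj j : (Fin n → k) →ₗ[k] k) ∘ₗ LinearMap.proj m),
    M.finite_toSet, E.finite_toSet, ?_, ?_⟩
  · funext x g i
    simp only [NUCA.nuca_apply, operator_apply, LinearMap.pi_apply, LinearMap.sum_apply,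
      LinearMap.smul_apply, LinearMap.comp_apply, LinearMap.proj_apply, smul_eq_mul]
    refine Finset.sum_congr rfl fun j _ => ?_
    rw [pair_eq_sum_of_subset _ _ _ (hM i j g), ← Finset.sum_coe_sort M]
    rfl
  · intro g h hg hh
    simp only [hE _ _ g hg, hE _ _ h hh]

/-- The ring homomorphism `M_n(D¹(k[G])) → LNUCA_c(G, k^n)`. -/
def toLNUCAc : Matrix (Fin n) (Fin n) (DOne k G) →+* NUCA.LNUCAc k G (Fin n → k) where
  toFun A := ⟨operator A, operator_mem A⟩
  map_one' := by
    refine Subtype.ext (LinearMap.ext fun x => funext fun g => funext fun i => ?_)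
    change operator 1 x g i = x g i
    rw [operator_apply, Finset.sum_eq_single i]
    · rw [Matrix.one_apply_eq, tot_one, MonoidAlgebra.one_def, pair_single, one_mul, mul_one]
    · intro j _ hj
      rw [Matrix.one_apply_ne hj.symm, tot_zero, pair_zero_left]
    · simp
  map_zero' := by
    refine Subtype.ext (LinearMap.ext fun x => funext fun g => funext fun i => ?_)
    change operator 0 x g i = 0
    simp [operator_apply, tot_zero]
  map_add' A B := by
    refine Subtype.ext (LinearMap.ext fun x => funext fun g => funext fun i => ?_)
    change operator (A + B) x g i = operator A x g i + operator B x g i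
    simp only [operator_apply, Matrix.add_apply, tot_add, pair_add_left, Finset.sum_add_distrib]
  map_mul' A B := by
    refine Subtype.ext (LinearMap.ext fun x => funext fun g => funext fun i => ?_)
    change operator (A * B) x g i = operator A (operator B x) g i
    simp only [operator_apply, Matrix.mul_apply, tot_sum, tot_mul, pair_sum_left, pair_twist,
      pair_sum_right]
    exact Finset.sum_comm

theorem coe_toLNUCAc (A : Matrix (Fin n) (Fin n) (DOne k G)) :
    (toLNUCAc A : Module.End k (G → Fin n → k)) = operator A := rfl

theorem toLNUCAc_injective [Infinite G] :
    Function.Injective (toLNUCAc (k := k) (G := G) (n := n)) := by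
  classical
  intro A B h
  have hop : operator A = operator B := congrArg Subtype.val h
  -- A matrix is read off from its operator by testing on delta configurations.
  have key : ∀ (C : Matrix (Fin n) (Fin n) (DOne k G)) (i j : Fin n) (g t : G),
      operator C (Pi.single (g * t) (Pi.single j 1)) g i = ((C i j).tot g).coeff t := by
    intro C i j g t
    rw [operator_apply, Finset.sum_eq_single j]
    · rw [← pair_delta]
      congr 1
      funext u
      by_cases hu : u = g * t
      · subst hu
        simp
      · simp [hu]
    · intro l _ hl
      have : (fun u => (Pi.single (g * t) (Pi.single j 1) : G → Fin n → k) u l) = fun _ => 0 := by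
        funext u
        by_cases hu : u = g * t
        · subst hu
          simp [hl]
        · simp [hu]
      rw [this]
      simp [pair]
    · simp
  ext1 i j
  refine ext_tot_of_infinite fun g => MonoidAlgebra.coeff_injective (Finsupp.ext fun t => ?_)
  rw [← key, ← key, hop]

end Operator

end

end DOne

/-! ### Every asymptotically constant linear NUCA comes from a matrix -/

namespace NUCA

noncomputable section

variable {k G : Type*} [Field k] [Group G] {n : ℕ}

/-- The `(i, j)` entry of a linear local map, as an element of the group algebra. -/
def entry {M : Set G} [Fintype M] (f : (M → Fin n → k) →ₗ[k] (Fin n → k)) (i j : Fin n) :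
    MonoidAlgebra k G :=
  open Classical in
  ∑ m : M, MonoidAlgebra.single (m : G) (f (Pi.single m (Pi.single j 1)) i)

theorem sum_pair_entry {M : Set G} [Fintype M] (f : (M → Fin n → k) →ₗ[k] (Fin n → k))
    (x : G → Fin n → k) (g : G) (i : Fin n) :
    ∑ j, DOne.pair (entry f i j) (fun u => x u j) g = f (fun m => x (g * m)) i := by
  classical
  -- Expand the pattern in the standard basis of `M → Fin n → k`, on which `entry` records the
  -- values of `f`.
  have hw : (fun m : M => x (g * m)) =
      ∑ j, ∑ m : M, x (g * m) j • (Pi.single m (Pi.single j 1) : M → Fin n → k) := by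
    funext m j
    simp only [Finset.sum_apply, Pi.smul_apply, smul_eq_mul]
    rw [Finset.sum_eq_single j, Finset.sum_eq_single m]
    · simp
    · intro m' _ hm
      simp [hm.symm]
    · simp
    · intro j' _ hj
      refine Finset.sum_eq_zero fun m' _ => ?_
      by_cases hm : m = m'
      · subst hm
        simp [hj.symm]
      · simp [hm]
    · simp
  rw [hw]
  simp only [map_sum, map_smul, Finset.sum_apply, Pi.smul_apply, smul_eq_mul, entry,
    DOne.pair_sum_left, DOne.pair_single]
  exact Finset.sum_congr rfl fun j _ => Finset.sum_congr rfl fun m _ => mul_comm _ _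

theorem toLNUCAc_surjective [Infinite G] :
    Function.Surjective (DOne.toLNUCAc (k := k) (G := G) (n := n)) := by
  classical
  rintro ⟨τ, M, E, s, hM, hE, hτ, hs⟩
  -- The regular part is the common local map off `E`, sampled at some `g₀` outside `E`.
  have := hM.fintype
  obtain ⟨g₀, hg₀⟩ := hE.exists_notMem
  refine ⟨Matrix.of fun i j => DOne.ofTot (fun g => entry (s g) i j) (entry (s g₀) i j)
    (hE.subset fun g hg => ?_), Subtype.ext (DFunLike.coe_injective ?_)⟩
  · by_contra h
    exact hg (by simp only [hs g g₀ h hg₀])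
  · change _ = (⇑τ : (G → Fin n → k) → (G → Fin n → k))
    rw [hτ, DOne.coe_toLNUCAc]
    funext x g i
    simp only [DOne.operator_apply, Matrix.of_apply, DOne.tot_ofTot, sum_pair_entry, nuca_apply]

variable (k G n) in
/-- `M_n(D¹(k[G])) ≃ LNUCA_c(G, k^n)` for infinite `G`. -/
def matrixEquivLNUCAc [Infinite G] :
    Matrix (Fin n) (Fin n) (DOne k G) ≃+* LNUCAc k G (Fin n → k) :=
  RingEquiv.ofBijective DOne.toLNUCAc ⟨DOne.toLNUCAc_injective, toLNUCAc_surjective⟩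

/-! ### Stable injectivity and left inverses -/

/-- To recover `x u`, the left inverse reads only the window `u * M'`. There `p` coincides with a
translate of `s`, so the local map `s'` at the translated point does the job. -/
theorem ConfigStablyInjective.of_leftInverse {A : Type*} {M M' : Set G} (hM' : M'.Finite)
    {s : G → ((M → A) → A)} {s' : G → ((M' → A) → A)}
    (h : Function.LeftInverse (nuca M' s') (nuca M s)) : ConfigStablyInjective M s := by
  classical
  intro p hp x y hxy
  funext u
  rw [mem_orbitClosure_iff] at hp
  obtain ⟨g, hg⟩ := hp (hM'.toFinset.image fun m => u * m)
  have agree : ∀ (z : G → A) (m : M'),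
      nuca M s (fun v => z (g * v)) (g⁻¹ * u * m) = nuca M p z (u * m) := by
    intro z m
    rw [nuca_apply, nuca_apply,
      hg (u * m) (Finset.mem_image_of_mem _ (hM'.mem_toFinset.2 m.2))]
    simp only [mul_assoc, mul_inv_cancel_left]
  have recover : ∀ z : G → A, z u = s' (g⁻¹ * u) (fun m => nuca M p z (u * m)) := by
    intro z
    have := congrFun (h fun v => z (g * v)) (g⁻¹ * u)
    rw [nuca_apply] at this
    simpa only [agree, mul_inv_cancel_left] using this.symm
  rw [recover x, recover y, hxy]

/-- In an infinite group some translate moves the finite set `E` off any given finite window. -/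
theorem const_mem_orbitClosure [Infinite G] {S : Type*} {s : G → S} {E : Set G}
    (hE : E.Finite) {c : S} (hs : ∀ g ∉ E, s g = c) : (fun _ => c) ∈ orbitClosure s := by
  classical
  rw [mem_orbitClosure_iff]
  intro F
  obtain ⟨g, hg⟩ := ((F.finite_toSet).image2 (fun h e => h * e⁻¹) hE).exists_notMem
  exact ⟨g, fun h hh => (hs _ fun he => hg ⟨h, hh, g⁻¹ * h, he, by simp⟩).symm⟩

theorem self_mem_orbitClosure {S : Type*} (s : G → S) : s ∈ orbitClosure s := by
  rw [mem_orbitClosure_iff]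
  exact fun _ => ⟨1, by simp⟩

end

end NUCA

/-! ### Duality for row-finite linear systems -/

/-- If a row-finite system of linear equations has only the zero solution, then every
coordinate is a finite linear combination of the equations. -/
theorem Finsupp.linearCombination_surjective_of_rows {k I J : Type*} [Field k]
    (a : J → I →₀ k) (h : ∀ x : I → k, (∀ i, Finsupp.linearCombination k x (a i) = 0) → x = 0) :
    Function.Surjective (Finsupp.linearCombination k a) := by
  rw [← LinearMap.range_eq_top]
  by_contra hne
  -- The dual of `I →₀ k` is `I → k`, so a nonzero functional killing the span of the rows is a
  -- nonzero solution of the system.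
  obtain ⟨f, hf, hle⟩ := Submodule.exists_le_ker_of_lt_top _ (lt_top_iff_ne_top.2 hne)
  have hfx : f = Finsupp.linearCombination k fun i => f (Finsupp.single i 1) := by
    ext i
    simp
  have h0 := h (fun i => f (Finsupp.single i 1)) fun i => by
    rw [← hfx]
    exact hle ⟨Finsupp.single i 1, by simp⟩
  exact hf (by rw [hfx, h0]; ext i; simp)

namespace NUCA

noncomputable section

variable {k G : Type*} [Field k] [Group G] {n : ℕ}

/-- An injective linear NUCA has a local left inverse at each point. -/
theorem exists_local_leftInverse {M : Set G} (hM : M.Finite)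
    (s : G → ((M → Fin n → k) →ₗ[k] (Fin n → k)))
    (hinj : Function.Injective (nuca M fun g => ⇑(s g))) (g : G) :
    ∃ c : Fin n → Fin n → MonoidAlgebra k G, ∀ x i,
      ∑ j, DOne.pair (c i j) (fun u => nuca M (fun g => ⇑(s g)) x u j) g = x g i := by
  classical
  have := hM.fintype
  -- The row `a (u, i)` expresses coordinate `i` of the output at `u` in the coordinates of the
  -- input.
  let a : G × Fin n → (G × Fin n →₀ k) := fun q =>
    ∑ j, (entry (s q.1) q.2 j).coeff.mapDomain fun t => (q.1 * t, j)
  have ha : ∀ (x : G × Fin n → k) q, Finsupp.linearCombination k x (a q)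
      = nuca M (fun g => ⇑(s g)) (fun u j => x (u, j)) q.1 q.2 := by
    intro x q
    rw [nuca_apply, ← sum_pair_entry (s q.1) (fun u j => x (u, j)), map_sum]
    refine Finset.sum_congr rfl fun j _ => ?_
    rw [Finsupp.linearCombination_mapDomain]
    rfl
  have hsurj := Finsupp.linearCombination_surjective_of_rows a fun x hx => by
    have h0 : (fun u j => x (u, j) : G → Fin n → k) = 0 := by
      apply hinj
      funext u i
      rw [← ha x (u, i), hx, nuca_apply]
      exact (congrFun (map_zero (s u)) i).symm
    funext q
    exact congrFun (congrFun h0 q.1) q.2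
  -- `b i` writes the coordinate `(g, i)` of the input as a finite combination of output
  -- coordinates. The factor `g⁻¹` below compensates for `pair` reading at `g * t`.
  choose b hb using fun i => hsurj (Finsupp.single (g, i) 1)
  refine ⟨fun i j => ∑ q ∈ (b i).support,
    if q.2 = j then MonoidAlgebra.single (g⁻¹ * q.1) (b i q) else 0, fun x i => ?_⟩
  have h1 : Finsupp.linearCombination k (fun q : G × Fin n => x q.1 q.2)
      (Finsupp.linearCombination k a (b i)) = x g i := by
    rw [hb]
    simp
  rw [← h1, Finsupp.linearCombination_apply k (b i), Finsupp.sum, map_sum]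
  simp only [map_smul, ha, smul_eq_mul, DOne.pair_sum_left]
  rw [Finset.sum_comm]
  refine Finset.sum_congr rfl fun q _ => ?_
  rw [Finset.sum_eq_single q.2]
  · rw [if_pos rfl, DOne.pair_single, mul_inv_cancel_left]
  · intro j _ hj
    rw [if_neg hj.symm, DOne.pair_zero_left]
  · simp

/-- Away from a finite set `B` one uses the same local left inverse `c₀`, that of the constant limit
automaton; at each point of `B`, a local left inverse of `τ` itself. -/
theorem exists_leftInverse [Infinite G] {τ : Module.End k (G → Fin n → k)}
    (hτ : τ ∈ LNUCAc k G (Fin n → k))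
    (hinj : StablyInjective (⇑τ : (G → Fin n → k) → (G → Fin n → k))) :
    ∃ ρ ∈ LNUCAc k G (Fin n → k), ρ * τ = 1 := by
  classical
  obtain ⟨M, E, s, hM, hE, hτs, hs⟩ := hτ
  obtain ⟨M', s', -, hτs', hinj⟩ := hinj
  -- Stable injectivity is witnessed by some other memory and configuration; transfer it to the
  -- asymptotically constant `s`.
  replace hinj := (configStablyInjective_iff (hτs.symm.trans hτs')).2 hinj
  obtain ⟨g₀, hg₀⟩ := hE.exists_notMem
  obtain ⟨c₀, hc₀⟩ := exists_local_leftInverse hM (fun _ => s g₀) (hinj _ <|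
    const_mem_orbitClosure hE fun g hg => by simp only [hs g g₀ hg hg₀]) 1
  choose c hc using exists_local_leftInverse hM s (hinj _ (self_mem_orbitClosure _))
  let N : Finset G := Finset.univ.biUnion fun i => Finset.univ.biUnion fun j =>
    (c₀ i j).coeff.support
  -- The points `g` whose window `g * N` meets `E`.
  let B : Set G := Set.image2 (fun e t => e * t⁻¹) E N
  have hB : B.Finite := hE.image2 _ N.finite_toSet
  let A : Matrix (Fin n) (Fin n) (DOne k G) := Matrix.of fun i j =>
    DOne.ofTot (fun g => if g ∈ B then c g i j else c₀ i j) (c₀ i j) <|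
      hB.subset fun g hg => by
        by_contra h
        exact hg (if_neg h)
  refine ⟨DOne.operator A, DOne.operator_mem A,
    LinearMap.ext fun x => funext fun g => funext fun i => ?_⟩
  change DOne.operator A (τ x) g i = x g i
  simp only [DOne.operator_apply, A, Matrix.of_apply, DOne.tot_ofTot, hτs]
  by_cases hg : g ∈ B
  · simp only [hg, if_true]
    exact hc g x i
  · simp only [hg, if_false]
    -- Translate from `1` to `g`: off `B`, the window of `c₀` at `g` avoids `E`, so there `τ` agrees
    -- with the constant automaton.
    have := hc₀ (fun u => x (g * u)) i
    rw [mul_one] at this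
    rw [← this]
    refine Finset.sum_congr rfl fun j _ => ?_
    rw [← DOne.pair_translate]
    refine DOne.pair_congr _ fun t ht => ?_
    have ht' : t ∈ N := by
      simp only [N, Finset.mem_biUnion, Finset.mem_univ, true_and]
      exact ⟨i, j, ht⟩
    have hgt : g * t ∉ E := fun h => hg ⟨g * t, h, t, ht', by simp⟩
    simp only [nuca_apply, one_mul, hs (g * t) g₀ hgt hg₀, mul_assoc]

end

end NUCA

/-! ### The equivalences -/

theorem theoremt {G k : Type*} [Group G] [Infinite G] [Field k] (n : ℕ) (hn : 1 ≤ n) :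
    List.TFAE
      [∀ τ ∈ NUCA.LNUCAc k G (Fin n → k),
          NUCA.StablyInjective (⇑τ : (G → Fin n → k) → (G → Fin n → k)) →
            Function.Surjective τ,
        IsDedekindFiniteMonoid (NUCA.LNUCAc k G (Fin n → k)),
        IsDedekindFiniteMonoid (Matrix (Fin n) (Fin n) (DOne k G))] := by
  tfae_have 1 → 2 := by
    refine fun H => ⟨fun {a b} hab => Subtype.ext (LinearMap.ext fun x => ?_)⟩
    have hab' : ∀ x, (a : Module.End k (G → Fin n → k)) ((b : Module.End k (G → Fin n → k)) x)
        = x := fun x => LinearMap.congr_fun (congrArg Subtype.val hab) x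
    obtain ⟨M, E, s, hM, -, hb, -⟩ := b.2
    obtain ⟨M', E', s', hM', -, ha, -⟩ := a.2
    -- The left inverse `a` makes `b` stably injective, hence surjective; then `b (a (b y)) = b y`
    -- gives `b * a = 1`.
    obtain ⟨y, rfl⟩ := H b b.2 ⟨M, fun g => ⇑(s g), hM, hb,
      .of_leftInverse hM' (s' := fun g => ⇑(s' g)) fun x => by rw [← hb, ← ha, hab']⟩ x
    change (b : Module.End k (G → Fin n → k)) ((a : Module.End k (G → Fin n → k)) _) = _
    rw [hab']
    rfl
  tfae_have 2 → 1 := by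
    intro H τ hτ hinj x
    obtain ⟨ρ, hρ, h⟩ := NUCA.exists_leftInverse hτ hinj
    have h1 : (⟨ρ, hρ⟩ * ⟨τ, hτ⟩ : NUCA.LNUCAc k G (Fin n → k)) = 1 := Subtype.ext h
    exact ⟨ρ x, LinearMap.congr_fun (congrArg Subtype.val (mul_eq_one_symm h1)) x⟩
  tfae_have 2 ↔ 3 := by
    let e := NUCA.matrixEquivLNUCAc k G n
    constructor
    · exact fun H => ⟨fun {a b} hab => e.injective <| by
        rw [map_mul, map_one]
        exact mul_eq_one_symm (by rw [← map_mul, hab, map_one])⟩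
    · exact fun H => ⟨fun {a b} hab => e.symm.injective <| by
        rw [map_mul, map_one]
        exact mul_eq_one_symm (by rw [← map_mul, hab, map_one])⟩
  tfae_finish
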